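/- All graphs are finite and simple. A connected dominating set of a graph $G$ is a set $D\subseteq V(G)$ such that every vertex of $G$ is in $D$ or adjacent to a vertex of $D$ and such that the induced subgraph $G[D]$ is connected; $\gamma_c(G)$ is the least cardinality of such a set ($\infty$ if there is none). A cut set of $G$ is a set $S\subseteq V(G)$ such that $G-S$ is disconnected; the connectivity $\kappa(G)$ is the least cardinality of a cut set (and $|V(G)|-1$ if $G$ is complete); a minimum cut set is a cut set of least cardinality; $\alpha(G)$ is the maximum cardinality of an independent set. A graph $G$ is maximal $3$-$\gamma_c$-vertex critical if it is $2$-connected (that is, $\kappa(G)\ge 2$), $\gamma_c(G)=3$, $\gamma_c(G+uv)<3$ for every two distinct non-adjacent vertices $u,v$ of $G$, and $\gamma_c(G-v)<3$ for every vertex $v$ of $G$. **Theorem.** Let $G$ be a maximal $3$-$\gamma_c$-vertex critical graph with $\alpha(G)=\kappa(G)$. Then for every minimum cut set $S$ of $G$, the graph $G-S$ has at least one component consisting of a single vertex. -/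

import Mathlib

namespace SimpleGraph

variable {V : Type*}

/-- `D` is a connected dominating set of `G`: every vertex is in `D` or adjacent to a vertex
of `D`, and the subgraph induced by `D` is connected. -/
def IsConnectedDominatingSet (G : SimpleGraph V) (D : Finset V) : Prop :=
  (∀ v, v ∈ D ∨ ∃ u ∈ D, G.Adj u v) ∧ (G.induce (D : Set V)).Connected

/-- The connected domination number: the least cardinality of a connected dominating set.
It is `⊤` if there is none (for instance if `G` is disconnected). -/
noncomputable def connectedDominationNumber (G : SimpleGraph V) : ℕ∞ :=
  ⨅ (D : Finset V) (_ : G.IsConnectedDominatingSet D), (D.card : ℕ∞)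

/-- `S` is a (vertex) cut set of `G`: two vertices of `G - S` are not joined by a walk in
`G - S`. -/
def IsCutSet (G : SimpleGraph V) (S : Finset V) : Prop :=
  ¬ (G.induce ((S : Set V)ᶜ)).Preconnected

/-- `S` is a cut set of minimum cardinality. -/
def IsMinimumCutSet (G : SimpleGraph V) (S : Finset V) : Prop :=
  G.IsCutSet S ∧ ∀ T : Finset V, G.IsCutSet T → S.card ≤ T.card

/-- The connectivity of a finite graph: the least cardinality of a cut set, with the usual
convention that a graph without cut sets (a complete graph) on `n ≥ 1` vertices has
connectivity `n - 1`. (If there is a cut set, a smallest one leaves at least two vertices, so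
that the second alternative does not matter.) -/
noncomputable def connectivity (G : SimpleGraph V) : ℕ :=
  sInf {k | ∃ S : Finset V, S.card = k ∧ (G.IsCutSet S ∨ ((S : Set V)ᶜ).Subsingleton)}

/-- `k`-`γ_c`-edge critical: `γ_c(G) = k`, and `γ_c(G + uv) < k` for all non-adjacent `u ≠ v`. -/
def IsConnectedDominationEdgeCritical (G : SimpleGraph V) (k : ℕ) : Prop :=
  G.connectedDominationNumber = k ∧
    ∀ u v : V, u ≠ v → ¬ G.Adj u v → (G ⊔ edge u v).connectedDominationNumber < k

/-- `k`-`γ_c`-vertex critical: `G` is 2-connected, `γ_c(G) = k`, and `γ_c(G - v) < k` for every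
vertex `v`. -/
def IsConnectedDominationVertexCritical (G : SimpleGraph V) (k : ℕ) : Prop :=
  2 ≤ G.connectivity ∧ G.connectedDominationNumber = k ∧
    ∀ v : V, (G.induce ({v}ᶜ : Set V)).connectedDominationNumber < k

/-- Maximal `k`-`γ_c`-vertex critical: both edge critical and vertex critical. -/
def IsMaximalConnectedDominationVertexCritical (G : SimpleGraph V) (k : ℕ) : Prop :=
  G.IsConnectedDominationEdgeCritical k ∧ G.IsConnectedDominationVertexCritical k

end SimpleGraph

/-! Suppose that no component of `G - S` is a single vertex. Then `G - S` splits into sides `A` and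
`B`, with no edge between them and an edge inside each. Criticality enters only through edges that
dominate all vertices but one. Every vertex is missed by such an edge, and two non-adjacent vertices
either dominate `G` together or one of them lies on such an edge missing the other. Each such edge
has an end in `S`, for an edge inside one side leaves the other side undominated.

If `|S| = 2`, three independent vertices appear, against `α = κ`. Otherwise take an independent set
`I` with `|I| = |S| ≥ 3`. Two vertices of `I` never dominate a third, so any two are joined by an
arc: write `a → b` via `w` if the edge `aw` dominates all but `b`. For `a ∉ S` the vertex `w` lies
in `S \ I` and misses only `b` in `I`. Distinct heads thus use distinct `w`, and `|I \ S| = |S \ I|`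
makes the arcs inside `I \ S` account for almost all of `S \ I`.

If some `o ∈ I \ S` has arcs to all the rest of `I \ S` (`King`), one vertex `r` of `S \ I` is left
over, and each placement of `I` forces contradictory adjacencies of `r`, or a vertex of too small
degree. If there is no such `o` (`Kingless`), every vertex of `I \ S` is a head, nothing is left
over, and comparing the arcs between the two sides gives the contradiction. -/

namespace SimpleGraph

variable {V : Type*}

/-- The edge `uw` dominates every vertex but `v`, and does not dominate `v`. -/
structure DominatesAllBut (G : SimpleGraph V) (u w v : V) : Prop where
  adj : G.Adj u w
  left_ne : u ≠ v
  right_ne : w ≠ v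
  left : ¬ G.Adj u v
  right : ¬ G.Adj w v
  dom : ∀ x, x ≠ v → x ≠ u → x ≠ w → G.Adj u x ∨ G.Adj w x

theorem DominatesAllBut.symm {G : SimpleGraph V} {u w v : V} (h : G.DominatesAllBut u w v) :
    G.DominatesAllBut w u v :=
  ⟨h.adj.symm, h.right_ne, h.left_ne, h.right, h.left, fun x hv hw hu => (h.dom x hv hu hw).symm⟩

/-- The cut set `S` separates `A` from `B`, both of which contain an edge, in a graph with the
local consequences of being maximal `3`-`γ_c`-vertex critical. -/
structure CriticalSeparation (G : SimpleGraph V) (S : Finset V) (A B : Set V) : Prop where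
  cover : ∀ v, v ∈ S ∨ v ∈ A ∨ v ∈ B
  notMem_left : ∀ v ∈ A, v ∉ S
  notMem_right : ∀ v ∈ B, v ∉ S
  disjoint : ∀ v ∈ A, v ∉ B
  not_adj : ∀ a ∈ A, ∀ b ∈ B, ¬ G.Adj a b
  edge_left : ∃ a ∈ A, ∃ a' ∈ A, G.Adj a a'
  edge_right : ∃ b ∈ B, ∃ b' ∈ B, G.Adj b b'
  pair : ∀ u v, u ≠ v → ¬ G.Adj u v → (∀ x, x ≠ u → x ≠ v → G.Adj u x ∨ G.Adj v x) ∨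
    (∃ w, G.DominatesAllBut u w v) ∨ ∃ w, G.DominatesAllBut v w u
  vertex : ∀ v, ∃ x y, G.DominatesAllBut x y v
  card_le : ∀ (T : Finset V) (u v : V), u ≠ v → u ∉ T → v ∉ T →
    (∀ x, G.Adj v x → x ∈ T) → S.card ≤ T.card

namespace CriticalSeparation

variable {G : SimpleGraph V} {S : Finset V} {A B : Set V}

theorem swap (h : G.CriticalSeparation S A B) : G.CriticalSeparation S B A where
  cover v := by have := h.cover v; tauto
  notMem_left := h.notMem_right
  notMem_right := h.notMem_left
  disjoint v hB hA := h.disjoint v hA hB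
  not_adj b hb a ha hab := h.not_adj a ha b hb hab.symm
  edge_left := h.edge_right
  edge_right := h.edge_left
  pair := h.pair
  vertex := h.vertex
  card_le := h.card_le

theorem exists_ne_right (h : G.CriticalSeparation S A B) (v : V) : ∃ b ∈ B, b ≠ v := by
  obtain ⟨b, hb, b', hb', hbb⟩ := h.edge_right
  by_cases hv : b = v
  · exact ⟨b', hb', hv ▸ hbb.ne'⟩
  · exact ⟨b, hb, hv⟩

/-! ### Dominating edges and the cut set -/

theorem mem_of_mem_left (h : G.CriticalSeparation S A B) {u w v : V} (hu : u ∈ A)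
    (huw : G.DominatesAllBut u w v) : w ∈ S := by
  by_contra hw
  have hwA : w ∈ A := by
    rcases h.cover w with h1 | h1 | h1
    · exact absurd h1 hw
    · exact h1
    · exact absurd huw.adj (h.not_adj u hu w h1)
  obtain ⟨b, hb, hbv⟩ := h.exists_ne_right v
  rcases huw.dom b hbv (fun e => h.disjoint u hu (e ▸ hb)) (fun e => h.disjoint w hwA (e ▸ hb))
    with h1 | h1
  · exact h.not_adj u hu b hb h1
  · exact h.not_adj w hwA b hb h1

theorem mem_of_notMem (h : G.CriticalSeparation S A B) {u w v : V} (hu : u ∉ S)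
    (huw : G.DominatesAllBut u w v) : w ∈ S := by
  rcases h.cover u with h1 | h1 | h1
  · exact absurd h1 hu
  · exact h.mem_of_mem_left h1 huw
  · exact h.swap.mem_of_mem_left h1 huw

theorem exists_dominatesAllBut (h : G.CriticalSeparation S A B) (v : V) :
    ∃ s ∈ S, ∃ y, G.DominatesAllBut s y v := by
  obtain ⟨x, y, hxy⟩ := h.vertex v
  by_cases hx : x ∈ S
  · exact ⟨x, hx, y, hxy⟩
  · exact ⟨y, h.mem_of_notMem hx hxy, x, hxy.symm⟩

theorem exists_mem_not_adj (h : G.CriticalSeparation S A B) (v : V) :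
    ∃ s ∈ S, s ≠ v ∧ ¬ G.Adj s v := by
  obtain ⟨s, hs, y, hy⟩ := h.exists_dominatesAllBut v
  exact ⟨s, hs, hy.left_ne, hy.left⟩

/-! ### Cut sets with two vertices -/

/-- Otherwise `s` is complete to `A`. For an edge `aa'` in `A`, the dominating edge missing `a` then
has `t` as its end in `S`, and its other end, a neighbour of `t`, lies outside `A` and differs from
`s`. Hence it cannot dominate `a'`. -/
theorem exists_adj_of_pair (h : G.CriticalSeparation S A B) {s t : V}
    (hS : ∀ v, v ∈ S ↔ v = s ∨ v = t)
    (hst : ∀ a ∈ A, G.Adj s a ∨ G.Adj t a) :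
    ∃ a ∈ A, G.Adj t a := by
  by_contra! hcon
  obtain ⟨a, ha, a', ha', haa⟩ := h.edge_left
  obtain ⟨x, hx, y, hxy⟩ := h.exists_dominatesAllBut a
  have := hxy.dom a' haa.ne'
  have hy := h.cover y
  have := hxy.adj
  have := hxy.left
  have := hxy.right
  have := h.notMem_left
  have := h.not_adj a' ha'
  have := h.disjoint a' ha'
  grind [G.adj_comm]

/-- A separating pair yields three independent vertices. -/
theorem exists_three_of_card_eq_two (h : G.CriticalSeparation S A B) (hS : S.card = 2) :
    ∃ x y z, x ≠ y ∧ x ≠ z ∧ y ≠ z ∧ ¬ G.Adj x y ∧ ¬ G.Adj x z ∧ ¬ G.Adj y z := by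
  classical
  obtain ⟨s, t, hst, rfl⟩ := Finset.card_eq_two.1 hS
  have hmem : ∀ v, v ∈ ({s, t} : Finset V) ↔ v = s ∨ v = t := by simp
  by_contra! hcon
  have hnst : ¬ G.Adj s t := by
    obtain ⟨x, hx, hxs, hx'⟩ := h.exists_mem_not_adj s
    grind [G.adj_comm]
  have hex : ∀ v, v ≠ s → v ≠ t → G.Adj s v → ¬ G.Adj t v := by
    intro v _ _ _ _
    obtain ⟨x, hx, hxs, hx'⟩ := h.exists_mem_not_adj v
    grind
  have hor : ∀ v, v ≠ s → v ≠ t → G.Adj s v ∨ G.Adj t v := by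
    intro v h1 h2
    have := hcon s t v hst h1.symm h2.symm hnst
    tauto
  have hA := h.notMem_left
  have hB := h.notMem_right
  simp only [hmem, not_or] at hA hB
  -- By `hor` and `hex`, each vertex outside `S` has exactly one neighbour in `S`. Neighbours `a ∈
  -- A` and `b ∈ B` of `t` are therefore independent of `s`.
  obtain ⟨a, ha, hta⟩ := h.exists_adj_of_pair hmem
    (fun a ha => hor a (hA a ha).1 (hA a ha).2)
  obtain ⟨b, hb, htb⟩ := h.swap.exists_adj_of_pair hmem
    (fun a ha => hor a (hB a ha).1 (hB a ha).2)
  exact h.not_adj a ha b hb (hcon s a b (Ne.symm (hA a ha).1) (Ne.symm (hB b hb).1)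
    (fun e => h.disjoint a ha (e ▸ hb))
    (fun e => hex a (hA a ha).1 (hA a ha).2 e hta) (fun e => hex b (hB b hb).1 (hB b hb).2 e htb))

/-! ### Arcs on an independent set -/

variable {I : Finset V}

theorem notMem_and_adj_of_indep (hI : ∀ a ∈ I, ∀ b ∈ I, ¬ G.Adj a b) {a w b : V} (ha : a ∈ I)
    (h : G.DominatesAllBut a w b) :
    w ∉ I ∧ ∀ c ∈ I, c ≠ b → G.Adj w c := by
  have hw : w ∉ I := fun hw => hI a ha w hw h.adj
  refine ⟨hw, fun c hc hcb => ?_⟩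
  by_cases hca : c = a
  · exact hca ▸ h.adj.symm
  · exact (h.dom c hcb hca (fun e => hw (e ▸ hc))).resolve_left (hI a ha c hc)

theorem dominatesAllBut_or (h : G.CriticalSeparation S A B)
    (hI : ∀ a ∈ I, ∀ b ∈ I, ¬ G.Adj a b) (hc : 3 ≤ I.card) {a b : V} (ha : a ∈ I) (hb : b ∈ I)
    (hab : a ≠ b) :
    (∃ w, G.DominatesAllBut a w b) ∨ ∃ w, G.DominatesAllBut b w a := by
  classical
  rcases h.pair a b hab (hI a ha b hb) with h1 | h1
  · exfalso
    have : ((I.erase a).erase b).Nonempty := by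
      rw [← Finset.card_pos, Finset.card_erase_of_mem (by simp [hb, hab.symm]),
        Finset.card_erase_of_mem ha]
      omega
    obtain ⟨c, hc⟩ := this
    simp only [Finset.mem_erase] at hc
    rcases h1 c hc.2.1 hc.1 with h2 | h2
    · exact hI a ha c hc.2.2 h2
    · exact hI b hb c hc.2.2 h2
  · exact h1

/-- If one vertex `o` of `I \ S` has a dominating edge missing `t` for every other `t ∈ I \ S`,
then these edges account for all vertices of `S \ I` but one. -/
theorem exists_remaining [DecidableEq V] (hcard : I.card = S.card) {o : V} {f : V → V}
    (ho : o ∈ I) (hoS : o ∉ S)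
    (hf : ∀ t ∈ I, t ∉ S → t ≠ o → f t ∈ S ∧ f t ∉ I)
    (hinj : ∀ t ∈ I, t ∉ S → t ≠ o → ∀ t' ∈ I, t' ∉ S → t' ≠ o → f t = f t' → t = t') :
    ∃ r ∈ S, r ∉ I ∧
      ∀ s ∈ S, s ∉ I → s ≠ r → ∃ t ∈ I, t ∉ S ∧ t ≠ o ∧ s = f t := by
  have h1 : (I \ S).card = (S \ I).card := Finset.card_sdiff_comm hcard
  have hsub : ((I \ S).erase o).image f ⊆ S \ I := by
    intro x hx
    simp only [Finset.mem_image, Finset.mem_erase, Finset.mem_sdiff] at hx ⊢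
    obtain ⟨t, ⟨h2, h3, h4⟩, rfl⟩ := hx
    exact hf t h3 h4 h2
  have h2 : (((I \ S).erase o).image f).card = (I \ S).card - 1 := by
    rw [Finset.card_image_of_injOn, Finset.card_erase_of_mem (by simp [ho, hoS])]
    intro t ht t' ht' e
    simp only [Finset.coe_erase, Set.mem_sdiff, Finset.mem_coe, Finset.mem_sdiff,
      Set.mem_singleton_iff] at ht ht'
    exact hinj t ht.1.1 ht.1.2 ht.2 t' ht'.1.1 ht'.1.2 ht'.2 e
  have h4 : 0 < (I \ S).card := Finset.card_pos.2 ⟨o, by simp [ho, hoS]⟩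
  have h3 : ((S \ I) \ ((I \ S).erase o).image f).card = 1 := by
    rw [Finset.card_sdiff_of_subset hsub, h2]
    omega
  obtain ⟨r, hr⟩ := Finset.card_eq_one.1 h3
  have hmem : ∀ x, (x ∈ S ∧ x ∉ I) ∧ (¬ ∃ t ∈ (I \ S).erase o, f t = x) ↔ x = r := by
    intro x
    rw [← Finset.mem_singleton, ← hr, Finset.mem_sdiff, Finset.mem_sdiff, Finset.mem_image]
  simp only [Finset.mem_erase, Finset.mem_sdiff] at hmem
  have hr' := (hmem r).2 rfl
  refine ⟨r, hr'.1.1, hr'.1.2, ?_⟩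
  intro s hs hsI hsr
  by_contra hcon
  refine hsr ((hmem s).1 ⟨⟨hs, hsI⟩, ?_⟩)
  rintro ⟨t, ⟨h5, h6, h7⟩, rfl⟩
  exact hcon ⟨t, h6, h7, h5, rfl⟩

/-! ### The case of a king -/

/-- An independent set `I` with `|I| ≥ 3` and a vertex `o ∈ I \ S` on the left side that
with `f t` dominates everything but `t`, for every other `t ∈ I \ S`; the vertex `r` is what
remains of `S \ I`. -/
structure King (G : SimpleGraph V) (S I : Finset V) (A B : Set V) (o r : V) (f : V → V) :
    Prop where
  sep : G.CriticalSeparation S A B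
  indep : ∀ a ∈ I, ∀ b ∈ I, ¬ G.Adj a b
  three_le : 3 ≤ I.card
  mem : o ∈ I
  mem_left : o ∈ A
  dom : ∀ t ∈ I, t ∉ S → t ≠ o → G.DominatesAllBut o (f t) t
  mem_S : r ∈ S
  notMem_I : r ∉ I
  exists_eq : ∀ s ∈ S, s ∉ I → s ≠ r → ∃ t ∈ I, t ∉ S ∧ t ≠ o ∧ s = f t

namespace King

variable {o r : V} {f : V → V}

theorem notMem_S (h : King G S I A B o r f) : o ∉ S := h.sep.notMem_left o h.mem_left

theorem f_mem (h : King G S I A B o r f) {t : V} (ht : t ∈ I) (htS : t ∉ S) (hto : t ≠ o) :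
    f t ∈ S ∧ f t ∉ I ∧ ∀ c ∈ I, c ≠ t → G.Adj (f t) c :=
  ⟨h.sep.mem_of_notMem h.notMem_S (h.dom t ht htS hto),
    notMem_and_adj_of_indep h.indep h.mem (h.dom t ht htS hto)⟩

/-- Every vertex of `S \ I` other than `r` is complete to `I ∩ S` and to `o`, and misses at most
one vertex of the right side, which then belongs to `I`. -/
theorem adj_of_ne (h : King G S I A B o r f) {s : V} (hs : s ∈ S) (hsI : s ∉ I) (hsr : s ≠ r) :
    G.Adj s o ∧ (∀ z ∈ I, z ∈ S → G.Adj s z) ∧ (∀ b ∈ B, b ∉ I → G.Adj s b) ∧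
      ∀ w, w ∉ I → w ∉ S → ¬ G.Adj w o → G.Adj s w := by
  obtain ⟨t, ht, htS, hto, rfl⟩ := h.exists_eq s hs hsI hsr
  obtain ⟨h1, h2, h3⟩ := h.f_mem ht htS hto
  have h4 := h.dom t ht htS hto
  refine ⟨h4.adj.symm, fun z hz hzS => h3 z hz (fun e => htS (e ▸ hzS)), fun b hb hbI => ?_,
    fun w hw hwS hwo => ?_⟩
  · exact (h4.dom b (fun e => hbI (e ▸ ht)) (fun e => hbI (e ▸ h.mem))
      (fun e => h.sep.notMem_right b hb (e ▸ h1))).resolve_left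
      (h.sep.not_adj o h.mem_left b hb)
  · exact (h4.dom w (fun e => hw (e ▸ ht)) (fun e => hw (e ▸ h.mem))
      (fun e => hwS (e ▸ h1))).resolve_left (fun e => hwo e.symm)

/-- If a vertex `z` of `I ∩ S` dominates all but `o` with `w`, then `w = r` or `w ∉ S` misses
`r`. -/
theorem eq_or_not_adj (h : King G S I A B o r f) {z w : V} (hz : z ∈ I)
    (hw : G.DominatesAllBut z w o) : w = r ∨ (w ∉ S ∧ w ∉ I ∧ ¬ G.Adj w r ∧ G.Adj z r) := by
  obtain ⟨h1, h2⟩ := notMem_and_adj_of_indep h.indep hz hw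
  by_cases hwS : w ∈ S
  · left
    by_contra hwr
    exact hw.right (h.adj_of_ne hwS h1 hwr).1
  · right
    obtain ⟨s, hs, hsw, hsa⟩ := h.sep.exists_mem_not_adj w
    have hsI : s ∉ I := fun hsI => hsa (h2 s hsI (fun e => h.notMem_S (e ▸ hs))).symm
    have hsr : s = r := by
      by_contra hsr
      exact hsa ((h.adj_of_ne hs hsI hsr).2.2.2 w h1 hwS hw.right)
    subst hsr
    have hwr : ¬ G.Adj w s := fun e => hsa e.symm
    exact ⟨hwS, h1, hwr, (hw.dom s (fun e => hsI (e ▸ h.mem)) (fun e => hsI (e ▸ hz))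
      hsw).resolve_right hwr⟩

/-- No arc leads from `I \ S` into `I ∩ S`: it could only go via `r`, and then `z` would be the only
vertex of `I ∩ S` and the only vertex of `S` that any vertex of `B \ I` can miss. An edge inside `B`
refutes this. -/
theorem false_of_dominatesAllBut (h : King G S I A B o r f) {a z w : V} (ha : a ∈ I)
    (haS : a ∉ S) (hz : z ∈ I) (hzS : z ∈ S) (hw : G.DominatesAllBut a w z) : False := by
  have key : ∀ a ∈ I, a ∉ S → ∀ z ∈ I, z ∈ S → ∀ w, G.DominatesAllBut a w z → w = r := by
    intro a ha haS z hz hzS w hw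
    obtain ⟨h1, h2⟩ := notMem_and_adj_of_indep h.indep ha hw
    by_contra hwr
    exact hw.right ((h.adj_of_ne (h.sep.mem_of_notMem haS hw) h1 hwr).2.1 z hz hzS)
  obtain rfl := key a ha haS z hz hzS w hw
  have hwz := hw.right
  have hwI := (notMem_and_adj_of_indep h.indep ha hw).2
  have hor : ∀ z ∈ I, z ∈ S → z ≠ o := fun z _ hzS e => h.notMem_S (e ▸ hzS)
  have hwo : G.Adj w o := hwI o h.mem (hor z hz hzS).symm
  -- `z` is reached from `o`
  have hoz : ∃ w, G.DominatesAllBut o w z := by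
    rcases h.sep.dominatesAllBut_or h.indep h.three_le h.mem hz (hor z hz hzS).symm with h1 | ⟨x, h1⟩
    · exact h1
    · exfalso
      rcases h.eq_or_not_adj hz h1 with rfl | h2
      · exact h1.right hwo
      · exact hwz h2.2.2.2.symm
  obtain ⟨w', hw'⟩ := hoz
  obtain rfl := key o h.mem h.notMem_S z hz hzS w' hw'
  have huniq : ∀ z' ∈ I, z' ∈ S → z' = z := by
    intro z' hz' hzS'
    rcases h.sep.dominatesAllBut_or h.indep h.three_le h.mem hz' (hor z' hz' hzS').symm
      with ⟨x, h1⟩ | ⟨x, h1⟩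
    · obtain rfl := key o h.mem h.notMem_S z' hz' hzS' x h1
      by_contra hne
      exact h1.right (hwI z' hz' hne)
    · exfalso
      rcases h.eq_or_not_adj hz' h1 with rfl | h2
      · exact h1.right hwo
      · rcases hw'.dom x (fun e => h2.2.1 (e ▸ hz)) h1.right_ne (fun e => h2.1 (e ▸ h.mem_S))
          with h3 | h3
        · exact h1.right h3.symm
        · exact h2.2.2.1 h3.symm
  -- every vertex of `B \ I` misses only `z` in `S`
  have hB : ∀ b ∈ B, b ∉ I → ∀ s ∈ S, ¬ G.Adj s b → s = z := by
    intro b hb hbI s hs hsb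
    by_cases hsI : s ∈ I
    · exact huniq s hsI hs
    · exfalso
      by_cases hsr : s = w'
      · subst hsr
        exact hsb ((hw'.dom b (fun e => hbI (e ▸ hz)) (fun e => hbI (e ▸ h.mem))
          (fun e => h.sep.notMem_right b hb (e ▸ hs))).resolve_left
          (h.sep.not_adj o h.mem_left b hb))
      · exact hsb ((h.adj_of_ne hs hsI hsr).2.2.1 b hb hbI)
  have hD : ∀ b ∈ B, b ∉ I → ∀ b' ∈ B, b' ≠ b → G.Adj z b' := by
    intro b hb hbI b' hb' hbb
    obtain ⟨s, hs, y, hy⟩ := h.sep.exists_dominatesAllBut b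
    obtain rfl := hB b hb hbI s hs hy.left
    have hyS : y ∉ S := fun hyS => hy.adj.ne (hB b hb hbI y hyS hy.right).symm
    have hyA : y ∈ A := by
      rcases h.sep.cover y with h1 | h1 | h1
      · exact absurd h1 hyS
      · exact h1
      · exfalso
        have hob : o ≠ b := fun e => hbI (e ▸ h.mem)
        have hoy : o ≠ y := fun e => h.sep.disjoint o h.mem_left (e ▸ h1)
        rcases hy.dom o hob (hor s hz hzS).symm hoy with h2 | h2
        · exact h.indep s hz o h.mem h2
        · exact h.sep.not_adj o h.mem_left y h1 h2.symm
    exact (hy.dom b' hbb (fun e => h.sep.notMem_right b' hb' (e ▸ hs))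
      (fun e => h.sep.disjoint y hyA (e ▸ hb'))).resolve_right (h.sep.not_adj y hyA b' hb')
  obtain ⟨b, hb, b', hb', hbb⟩ := h.sep.edge_right
  -- By `hD`, `z` is adjacent to `b'`, which puts `b'` outside `I`; so `z` is also adjacent to `b`,
  -- and `b` would miss nothing in `S`.
  have hone : ∀ b ∈ B, ∀ b' ∈ B, G.Adj b b' → b ∉ I → False := by
    intro b hb b' hb' hbb hbI
    have h1 := hD b hb hbI b' hb' hbb.ne'
    have hbI' : b' ∉ I := fun e => h.indep z hz b' e h1
    have h2 := hD b' hb' hbI' b hb hbb.ne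
    obtain ⟨s, hs, -, hsb⟩ := h.sep.exists_mem_not_adj b
    exact hsb (hB b hb hbI s hs hsb ▸ h2)
  by_cases hbI : b ∈ I
  · exact hone b' hb' b hb hbb.symm (fun e => h.indep b hbI b' e hbb)
  · exact hone b hb b' hb' hbb hbI

/-- `S \ I` is complete to `S ∩ I`. -/
theorem adj_of_mem (h : King G S I A B o r f) {s z : V} (hs : s ∈ S) (hsI : s ∉ I) (hz : z ∈ I)
    (hzS : z ∈ S) : G.Adj s z := by
  by_cases hsr : s = r
  · subst hsr
    have hzo : z ≠ o := fun e => h.notMem_S (e ▸ hzS)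
    rcases h.sep.dominatesAllBut_or h.indep h.three_le hz h.mem hzo with ⟨w, hw⟩ | ⟨w, hw⟩
    · rcases h.eq_or_not_adj hz hw with rfl | h1
      · exact hw.adj.symm
      · exact h1.2.2.2.symm
    · exact (h.false_of_dominatesAllBut h.mem h.notMem_S hz hzS hw).elim
  · exact (h.adj_of_ne hs hsI hsr).2.1 z hz hzS

end King
-- With `S \ I` complete to `B`, a dominating edge `sy` missing `b ∈ B` has `s ∈ I ∩ S` and `y ∉ S`.
-- As `y` must dominate the rest of `I ∩ S`, any vertex of `S` that it misses lies in `S \ I`, which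
-- excludes `y ∈ B`.
theorem exists_left_not_adj (h : G.CriticalSeparation S A B)
    (hI : ∀ a ∈ I, ∀ b ∈ I, ¬ G.Adj a b) {b : V} (hb : b ∈ B)
    (hfull : ∀ s ∈ S, s ∉ I → ∀ b ∈ B, G.Adj s b) :
    ∃ y ∈ A, y ∉ I ∧ ∃ q ∈ S, q ∉ I ∧ q ≠ y ∧ ¬ G.Adj q y := by
  obtain ⟨s, hs, y, hy⟩ := h.exists_dominatesAllBut b
  have hsI : s ∈ I := by
    by_contra hsI
    exact hy.left (hfull s hs hsI b hb)
  have hyI : y ∉ I := fun e => hI s hsI y e hy.adj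
  have hyS : y ∉ S := fun e => hy.right (hfull y e hyI b hb)
  obtain ⟨q, hq, hqy, hqa⟩ := h.exists_mem_not_adj y
  have hqI : q ∉ I := fun e => by
    have hqs : q ≠ s := fun e => hqa (e ▸ hy.adj)
    exact hqa ((hy.dom q (fun e => h.notMem_right b hb (e ▸ hq)) hqs hqy).resolve_left
      (hI s hsI q e)).symm
  have hyB : y ∉ B := fun e => hqa (hfull q hq hqI y e)
  have hyA : y ∈ A := by have := h.cover y; tauto
  exact ⟨y, hyA, hyI, q, hq, hqI, hqy, hqa⟩

namespace King

variable {o r : V} {f : V → V}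

/-- A dominating edge missing `b ∈ B \ I` with an end `s ∈ I ∩ S` has its other end outside
`S`, unless that end is `r`. -/
theorem notMem_of_mem (h : King G S I A B o r f) {b s y : V} (hb : b ∈ B) (hbI : b ∉ I)
    (hs : s ∈ I) (hy : G.DominatesAllBut s y b) (hyr : y ≠ r) : y ∉ S := by
  intro hyS
  have hyI : y ∉ I := fun e => h.indep s hs y e hy.adj
  exact hy.right ((h.adj_of_ne hyS hyI hyr).2.2.1 b hb hbI)

/-- Comparing `o` with the vertices of `B` yields arcs via `r` only. An edge inside `B` rules out
that `r` is adjacent to `o`, so `r` is complete to `B` and to `A` except for `o`. This makes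
`exists_left_not_adj` applicable. -/
theorem false_of_forall_notMem (h : King G S I A B o r f)
    (hB : ∀ b ∈ B, b ∉ I) : False := by
  have hoB : o ∉ B := h.sep.disjoint o h.mem_left
  -- a non-neighbour of `r` in `S` provides a second vertex of `I \ S`
  obtain ⟨t, ht, htS, hto⟩ : ∃ t ∈ I, t ∉ S ∧ t ≠ o := by
    obtain ⟨s, hs, hsr, hsa⟩ := h.sep.exists_mem_not_adj r
    have hsI : s ∉ I := fun e => hsa (h.adj_of_mem h.mem_S h.notMem_I e hs).symm
    obtain ⟨t, ht, htS, hto, -⟩ := h.exists_eq s hs hsI hsr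
    exact ⟨t, ht, htS, hto⟩
  have hcases : ∀ b ∈ B, (G.Adj r b ∧ ¬ G.Adj r o ∧ ∀ a ∈ A, a ≠ o → a ≠ r → G.Adj r a) ∨
      (G.Adj r o ∧ ¬ G.Adj r b ∧ ∀ b' ∈ B, b' ≠ b → G.Adj r b') := by
    intro b hb
    have hbt : b ≠ t := fun e => hB b hb (e ▸ ht)
    have hbS := h.sep.notMem_right b hb
    have htB : t ∉ B := fun e => hB t e ht
    have htA : t ∈ A := by have := h.sep.cover t; tauto
    rcases h.sep.pair b o (fun e => hoB (e ▸ hb))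
      (fun e => h.sep.not_adj o h.mem_left b hb e.symm) with h1 | ⟨w, h1⟩ | ⟨w, h1⟩
    · exfalso
      rcases h1 t hbt.symm hto with h2 | h2
      · exact h.sep.not_adj t htA b hb h2.symm
      · exact h.indep o h.mem t ht h2
    · left
      have hwS := h.sep.mem_of_notMem hbS h1
      have hwt : G.Adj w t := (h1.dom t hto hbt.symm (fun e => htS (e ▸ hwS))).resolve_left
        (fun e => h.sep.not_adj t htA b hb e.symm)
      have hwI : w ∉ I := fun e => h.indep w e t ht hwt
      have hwr : w = r := by
        by_contra hwr
        exact h1.right (h.adj_of_ne hwS hwI hwr).1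
      subst hwr
      refine ⟨h1.adj.symm, h1.right, fun a ha hao haw => ?_⟩
      exact (h1.dom a hao (fun e => h.sep.disjoint a ha (e ▸ hb)) haw).resolve_left
        (fun e => h.sep.not_adj a ha b hb e.symm)
    · right
      have hwS := h.sep.mem_of_notMem h.notMem_S h1
      have hwI : w ∉ I := fun e => h.indep o h.mem w e h1.adj
      have hwr : w = r := by
        by_contra hwr
        exact h1.right ((h.adj_of_ne hwS hwI hwr).2.2.1 b hb (hB b hb))
      subst hwr
      refine ⟨h1.adj.symm, h1.right, fun b' hb' hbb => ?_⟩
      exact (h1.dom b' hbb (fun e => hoB (e ▸ hb'))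
        (fun e => h.sep.notMem_right b' hb' (e ▸ hwS))).resolve_left
        (h.sep.not_adj o h.mem_left b' hb')
  obtain ⟨b, hb, b', hb', hbb⟩ := h.sep.edge_right
  have hro : ¬ G.Adj r o := by
    intro hro
    rcases hcases b hb with h1 | h1
    · exact h1.2.1 hro
    · rcases hcases b' hb' with h2 | h2
      · exact h2.2.1 hro
      · exact h2.2.1 (h1.2.2 b' hb' hbb.ne')
  have hrB : ∀ b ∈ B, G.Adj r b := fun b hb => by
    rcases hcases b hb with h1 | h1
    · exact h1.1
    · exact absurd h1.1 hro
  have hrA : ∀ a ∈ A, a ≠ o → a ≠ r → G.Adj r a := by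
    rcases hcases b hb with h1 | h1
    · exact h1.2.2
    · exact absurd h1.1 hro
  have hfull : ∀ s ∈ S, s ∉ I → ∀ b ∈ B, G.Adj s b := by
    intro s hs hsI b hb
    by_cases hsr : s = r
    · exact hsr ▸ hrB b hb
    · exact (h.adj_of_ne hs hsI hsr).2.2.1 b hb (hB b hb)
  obtain ⟨y, hyA, hyI, q, hq, hqI, hqy, hqa⟩ := h.sep.exists_left_not_adj h.indep hb hfull
  have hyB := h.sep.disjoint y hyA
  have hqr : q ≠ r := by
    rintro rfl
    exact hqa (hrA y hyA (fun e => hyI (e ▸ h.mem)) hqy.symm)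
  obtain ⟨u, hu, huS, huo, rfl⟩ := h.exists_eq q hq hqI hqr
  have huA : u ∈ A := by have := h.sep.cover u; have := hB u; tauto
  have hbu : b ≠ u := fun e => hB b hb (e ▸ hu)
  have hbo : b ≠ o := fun e => hB b hb (e ▸ h.mem)
  have hub : ¬ G.Adj u b := h.sep.not_adj u huA b hb
  rcases h.sep.pair b u hbu (fun e => hub e.symm) with h1 | ⟨w, h1⟩ | ⟨w, h1⟩
  · rcases h1 o hbo.symm huo.symm with h2 | h2
    · exact h.sep.not_adj o h.mem_left b hb h2.symm
    · exact h.indep u hu o h.mem h2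
  · have hwS := h.sep.mem_of_notMem (h.sep.notMem_right b hb) h1
    have hwo : G.Adj w o := (h1.dom o huo.symm hbo.symm (fun e => h.notMem_S (e ▸ hwS))).resolve_left
        (fun e => h.sep.not_adj o h.mem_left b hb e.symm)
    have hwI : w ∉ I := fun e => h.indep w e o h.mem hwo
    have hwr : w ≠ r := fun e => hro (e ▸ hwo)
    obtain ⟨v, hv, hvS, hvo, rfl⟩ := h.exists_eq w hwS hwI hwr
    have hvu : v = u := by
      by_contra hvu
      exact h1.right ((h.f_mem hv hvS hvo).2.2 u hu (Ne.symm hvu))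
    subst hvu
    exact hqa ((h1.dom y (fun e => hyI (e ▸ hv)) (fun e => hyB (e ▸ hb)) hqy.symm).resolve_left
      (fun e => h.sep.not_adj y hyA b hb e.symm))
  · have hwS := h.sep.mem_of_notMem huS h1
    have hwI : w ∉ I := fun e => h.indep u hu w e h1.adj
    exact h1.right (hfull w hwS hwI b hb)

/-- When `I` meets `B`, every dominating edge missing a vertex of `B \ I` must use `r`; thus `r`
misses all of `B \ I`, and no position of the other end of such an edge is possible. -/
theorem false (h : King G S I A B o r f) : False := by
  classical
  by_cases hex : ∃ c ∈ B, c ∈ I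
  swap
  · push Not at hex
    exact h.false_of_forall_notMem hex
  obtain ⟨c, hc, hcI⟩ := hex
  have hoB : o ∉ B := h.sep.disjoint o h.mem_left
  have hco : c ≠ o := fun e => hoB (e ▸ hc)
  have hcS := h.sep.notMem_right c hc
  have hfc := h.f_mem hcI hcS hco
  have hD : ∀ b ∈ B, b ∉ I → ∃ y, G.DominatesAllBut r y b ∧ (y ∉ S ∨ y ∈ I) := by
    intro b hb hbI
    have hyR : ∀ y, G.DominatesAllBut r y b → y ∉ S ∨ y ∈ I := by
      intro y hy
      by_contra! hcon
      exact hy.right ((h.adj_of_ne hcon.1 hcon.2 hy.adj.ne').2.2.1 b hb hbI)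
    obtain ⟨s, hs, y, hy⟩ := h.sep.exists_dominatesAllBut b
    by_cases hsr : s = r
    · subst hsr
      exact ⟨y, hy, hyR y hy⟩
    by_cases hsI : s ∈ I
    · by_cases hyr : y = r
      · subst hyr
        exact ⟨s, hy.symm, hyR s hy.symm⟩
      exfalso
      have hyS := h.notMem_of_mem hb hbI hsI hy hyr
      rcases h.sep.cover y with h1 | h1 | h1
      · exact hyS h1
      · have hcb : c ≠ b := fun e => hbI (e ▸ hcI)
        rcases hy.dom c hcb (fun e => hcS (e ▸ hs)) (fun e => h.sep.disjoint y h1 (e ▸ hc))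
          with h2 | h2
        · exact h.indep s hsI c hcI h2
        · exact h.sep.not_adj y h1 c hc h2
      · have hob : o ≠ b := fun e => hbI (e ▸ h.mem)
        rcases hy.dom o hob (fun e => h.notMem_S (e ▸ hs)) (fun e => hoB (e ▸ h1)) with h2 | h2
        · exact h.indep s hsI o h.mem h2
        · exact h.sep.not_adj o h.mem_left y h1 h2.symm
    · exact absurd ((h.adj_of_ne hs hsI hsr).2.2.1 b hb hbI) hy.left
  have hrb : ∀ b ∈ B, b ∉ I → ¬ G.Adj r b := fun b hb hbI => by
    obtain ⟨y, hy, -⟩ := hD b hb hbI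
    exact hy.left
  -- the degree of `c` rules out that `B \ I` is a single vertex
  have hdeg : ∀ b ∈ B, b ∉ I → (∃ z ∈ I, z ∈ S) → ¬ ∀ b' ∈ B, b' ∉ I → b' = b := by
    rintro b hb hbI ⟨z, hz, hzS⟩ huniq
    have hob : o ≠ b := fun e => hbI (e ▸ h.mem)
    have hbS := h.sep.notMem_right b hb
    have h1 := h.sep.card_le (insert b ((S \ I).erase (f c))) o c hco.symm
      (by simp [hob, h.mem]) (by simp [hcI]; exact fun e => hbI (e ▸ hcI)) (by
        intro x hx
        simp only [Finset.mem_insert, Finset.mem_erase, Finset.mem_sdiff]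
        have hxI : x ∉ I := fun e => h.indep c hcI x e hx
        rcases h.sep.cover x with h2 | h2 | h2
        · exact Or.inr ⟨fun e => (h.dom c hcI hcS hco).right (e ▸ hx.symm), h2, hxI⟩
        · exact absurd hx.symm (h.sep.not_adj x h2 c hc)
        · exact Or.inl (huniq x h2 hxI))
    -- The neighbours of `c` lie in `S` together with `b`, but without `z` and `f c`: at most `|S| -
    -- 1` vertices.
    have h2 : (S \ I).card < S.card := Finset.card_lt_card
      ⟨Finset.sdiff_subset, fun e => (Finset.mem_sdiff.1 (e hzS)).2 hz⟩
    have h3 := Finset.card_insert_le b ((S \ I).erase (f c))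
    have h4 : ((S \ I).erase (f c)).card = (S \ I).card - 1 :=
      Finset.card_erase_of_mem (by simp [hfc.1, hfc.2.1])
    have h5 : 0 < (S \ I).card := Finset.card_pos.2 ⟨f c, by simp [hfc.1, hfc.2.1]⟩
    omega
  have hZ : G.Adj r o → ∃ z ∈ I, z ∈ S := by
    intro hro
    obtain ⟨s, hs, hso, hsa⟩ := h.sep.exists_mem_not_adj o
    by_contra! hcon
    have hsI : s ∉ I := fun e => hcon s e hs
    by_cases hsr : s = r
    · exact hsa (hsr ▸ hro)
    · exact hsa (h.adj_of_ne hs hsI hsr).1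
  have hcomplete : ∀ b ∈ B, b ∉ I → (∃ z ∈ I, z ∈ S) ∧ ∀ c ∈ I, c ∉ A → G.Adj b c := by
    intro b hb hbI
    have hbo : b ≠ o := fun e => hbI (e ▸ h.mem)
    have hbS := h.sep.notMem_right b hb
    rcases h.sep.pair b o hbo
      (fun e => h.sep.not_adj o h.mem_left b hb e.symm) with h1 | ⟨w, h1⟩ | ⟨w, h1⟩
    · have hro : G.Adj r o := by
        rcases h1 r (fun e => hbS (e ▸ h.mem_S)) (fun e => h.notMem_I (e ▸ h.mem)) with h2 | h2
        · exact absurd h2.symm (hrb b hb hbI)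
        · exact h2.symm
      refine ⟨hZ hro, fun x hx hxA => ?_⟩
      exact (h1 x (fun e => hbI (e ▸ hx)) (fun e => hxA (e ▸ h.mem_left))).resolve_right
        (h.indep o h.mem x hx)
    · have hwS := h.sep.mem_of_notMem hbS h1
      have hwI : w ∈ I := by
        by_contra hwI
        by_cases hwr : w = r
        · exact hrb b hb hbI (hwr ▸ h1.adj.symm)
        · exact h1.right (h.adj_of_ne hwS hwI hwr).1
      refine ⟨⟨w, hwI, hwS⟩, fun x hx hxA => ?_⟩
      by_cases hxw : x = w
      · exact hxw ▸ h1.adj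
      · exact (h1.dom x (fun e => hxA (e ▸ h.mem_left)) (fun e => hbI (e ▸ hx)) hxw).resolve_right
          (h.indep w hwI x hx)
    · exfalso
      have hwS := h.sep.mem_of_notMem h.notMem_S h1
      have hwI : w ∉ I := fun e => h.indep o h.mem w e h1.adj
      have hwr : w = r := by
        by_contra hwr
        exact h1.right ((h.adj_of_ne hwS hwI hwr).2.2.1 b hb hbI)
      subst hwr
      refine hdeg b hb hbI (hZ h1.adj.symm) (fun b' hb' hbI' => ?_)
      by_contra hbb
      exact hrb b' hb' hbI' ((h1.dom b' hbb (fun e => hoB (e ▸ hb'))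
        (fun e => h.sep.notMem_right b' hb' (e ▸ hwS))).resolve_left
        (h.sep.not_adj o h.mem_left b' hb'))
  obtain ⟨b, hb, hbI⟩ : ∃ b ∈ B, b ∉ I := by
    obtain ⟨b, hb, b', hb', hbb⟩ := h.sep.edge_right
    by_cases hbI : b ∈ I
    · exact ⟨b', hb', fun e => h.indep b hbI b' e hbb⟩
    · exact ⟨b, hb, hbI⟩
  obtain ⟨hz, hbc⟩ := hcomplete b hb hbI
  obtain ⟨y, hy, hyS⟩ := hD b hb hbI
  have hyI : y ∉ I ∨ y ∈ A := by
    by_contra! hcon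
    exact hy.right (hbc y hcon.1 hcon.2).symm
  rcases h.sep.cover y with h1 | h1 | h1
  · have := h.sep.notMem_left y
    tauto
  · refine hdeg b hb hbI hz (fun b' hb' hbI' => ?_)
    by_contra hbb
    exact hrb b' hb' hbI' ((hy.dom b' hbb (fun e => h.sep.notMem_right b' hb' (e ▸ h.mem_S))
      (fun e => h.sep.disjoint y h1 (e ▸ hb'))).resolve_right (h.sep.not_adj y h1 b' hb'))
  · have hyA : y ∉ A := fun e => h.sep.disjoint y e h1
    exact hrb y h1 (hyI.resolve_right hyA) hy.adj

end King

/-- No vertex of `I \ S` has dominating edges missing each other vertex of `I \ S`. -/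
theorem false_of_king (h : G.CriticalSeparation S A B)
    (hI : ∀ a ∈ I, ∀ b ∈ I, ¬ G.Adj a b) (hcard : I.card = S.card) (h3 : 3 ≤ I.card) {o : V}
    (ho : o ∈ I) (hoS : o ∉ S)
    (hdom : ∀ t ∈ I, t ∉ S → t ≠ o → ∃ w, G.DominatesAllBut o w t) : False := by
  classical
  choose! f hf using hdom
  obtain ⟨r, hr, hrI, hex⟩ := exists_remaining hcard (f := f) ho hoS
    (fun t ht htS hto => ⟨h.mem_of_notMem hoS (hf t ht htS hto),
      (notMem_and_adj_of_indep hI ho (hf t ht htS hto)).1⟩)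
    (fun t ht htS hto t' ht' htS' hto' e => by
      by_contra htt
      exact (hf t ht htS hto).right (e ▸
        (notMem_and_adj_of_indep hI ho (hf t' ht' htS' hto')).2 t ht htt))
  rcases h.cover o with h1 | h1 | h1
  · exact hoS h1
  · exact King.false ⟨h, hI, h3, ho, h1, hf, hr, hrI, hex⟩
  · exact King.false ⟨h.swap, hI, h3, ho, h1, hf, hr, hrI, hex⟩

/-! ### The case without a king -/

/-- An independent set `I` with `|I| = |S| ≥ 3` such that every `t ∈ I \ S` is the only vertex not
dominated by `f t` and some other vertex of `I \ S`; then `f` maps `I \ S` onto `S \ I`. -/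
structure Kingless (G : SimpleGraph V) (S I : Finset V) (A B : Set V) (f : V → V) : Prop where
  sep : G.CriticalSeparation S A B
  indep : ∀ a ∈ I, ∀ b ∈ I, ¬ G.Adj a b
  card_eq : I.card = S.card
  three_le : 3 ≤ I.card
  source : ∀ t ∈ I, t ∉ S → ∃ o ∈ I, o ∉ S ∧ o ≠ t ∧ G.DominatesAllBut o (f t) t
  no_king : ∀ o ∈ I, o ∉ S → ∃ t ∈ I, t ∉ S ∧ t ≠ o ∧ ∀ w, ¬ G.DominatesAllBut o w t

namespace Kingless

variable {f : V → V}

theorem swap (h : Kingless G S I A B f) : Kingless G S I B A f :=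
  ⟨h.sep.swap, h.indep, h.card_eq, h.three_le, h.source, h.no_king⟩

theorem f_mem (h : Kingless G S I A B f) {t : V} (ht : t ∈ I) (htS : t ∉ S) :
    f t ∈ S ∧ f t ∉ I ∧ ¬ G.Adj (f t) t ∧ ∀ c ∈ I, c ≠ t → G.Adj (f t) c := by
  obtain ⟨o, ho, hoS, -, hd⟩ := h.source t ht htS
  have := notMem_and_adj_of_indep h.indep ho hd
  exact ⟨h.sep.mem_of_notMem hoS hd, this.1, hd.right, this.2⟩

theorem exists_eq (h : Kingless G S I A B f) {s : V} (hs : s ∈ S) (hsI : s ∉ I) :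
    ∃ t ∈ I, t ∉ S ∧ s = f t := by
  classical
  have hcard : (I \ S).card = (S \ I).card := Finset.card_sdiff_comm h.card_eq
  have hinj : Set.InjOn f ((I \ S : Finset V) : Set V) := by
    intro t ht t' ht' e
    simp only [Finset.coe_sdiff, Set.mem_sdiff, Finset.mem_coe] at ht ht'
    by_contra hne
    exact (h.f_mem ht.1 ht.2).2.2.1 (e ▸ (h.f_mem ht'.1 ht'.2).2.2.2 t ht.1 hne)
  have hmaps : Set.MapsTo f ((I \ S : Finset V) : Set V) ((S \ I : Finset V) : Set V) := by
    intro t ht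
    simp only [Finset.coe_sdiff, Set.mem_sdiff, Finset.mem_coe] at ht ⊢
    exact ⟨(h.f_mem ht.1 ht.2).1, (h.f_mem ht.1 ht.2).2.1⟩
  obtain ⟨t, ht, e⟩ := Finset.surjOn_of_injOn_of_card_le f hmaps hinj hcard.ge
    (by simp [hs, hsI] : s ∈ ((S \ I : Finset V) : Set V))
  simp only [Finset.coe_sdiff, Set.mem_sdiff, Finset.mem_coe] at ht
  exact ⟨t, ht.1, ht.2, e.symm⟩

theorem eq_of_not_adj (h : Kingless G S I A B f) {s t : V} (hs : s ∈ S) (hsI : s ∉ I)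
    (ht : t ∈ I) (hst : ¬ G.Adj s t) : t ∉ S ∧ s = f t := by
  obtain ⟨u, hu, huS, rfl⟩ := h.exists_eq hs hsI
  have : u = t := by
    by_contra hne
    exact hst ((h.f_mem hu huS).2.2.2 t ht (Ne.symm hne))
  exact this ▸ ⟨huS, rfl⟩

/-- A dominating edge missing `t ∈ I` with one end in `I \ S` has `f t` as its other end. -/
theorem eq_of_dominatesAllBut (h : Kingless G S I A B f) {o w t : V} (ho : o ∈ I) (hoS : o ∉ S)
    (ht : t ∈ I) (hw : G.DominatesAllBut o w t) : w = f t :=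
  (h.eq_of_not_adj (h.sep.mem_of_notMem hoS hw) (notMem_and_adj_of_indep h.indep ho hw).1 ht
    hw.right).2

theorem exists_right (h : Kingless G S I A B f) : ∃ b ∈ B, b ∈ I := by
  by_contra! hB
  have hfull : ∀ s ∈ S, s ∉ I → ∀ b ∈ B, G.Adj s b := by
    intro s hs hsI b hb
    obtain ⟨t, ht, htS, rfl⟩ := h.exists_eq hs hsI
    obtain ⟨o, ho, hoS, hot, hd⟩ := h.source t ht htS
    have hoA : o ∈ A := by have := h.sep.cover o; have := hB o; tauto
    exact (hd.dom b (fun e => hB b hb (e ▸ ht)) (fun e => hB b hb (e ▸ ho))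
      (fun e => h.sep.notMem_right b hb (e ▸ hs))).resolve_left (h.sep.not_adj o hoA b hb)
  obtain ⟨b, hb, -⟩ := h.sep.edge_right
  obtain ⟨y, hyA, hyI, q, hq, hqI, hqy, hqa⟩ := h.sep.exists_left_not_adj h.indep hb hfull
  obtain ⟨u, hu, huS, rfl⟩ := h.exists_eq hq hqI
  obtain ⟨o, ho, hoS, hou, -⟩ := h.no_king u hu huS
  have hAmem : ∀ t ∈ I, t ∉ S → t ∈ A := fun t ht htS => by
    have := h.sep.cover t; have := hB t; tauto
  have huA := hAmem u hu huS
  have hoA := hAmem o ho hoS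
  have hbu : b ≠ u := fun e => hB b hb (e ▸ hu)
  have hbo : b ≠ o := fun e => hB b hb (e ▸ ho)
  have hub : ¬ G.Adj u b := h.sep.not_adj u huA b hb
  rcases h.sep.pair b u hbu (fun e => hub e.symm) with h1 | ⟨w, h1⟩ | ⟨w, h1⟩
  · rcases h1 o hbo.symm hou with h2 | h2
    · exact h.sep.not_adj o hoA b hb h2.symm
    · exact h.indep u hu o ho h2
  · have hwS := h.sep.mem_of_notMem (h.sep.notMem_right b hb) h1
    have hwo : G.Adj w o := (h1.dom o hou hbo.symm (fun e => hoS (e ▸ hwS))).resolve_left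
        (fun e => h.sep.not_adj o hoA b hb e.symm)
    have hwI : w ∉ I := fun e => h.indep w e o ho hwo
    obtain ⟨-, rfl⟩ := h.eq_of_not_adj hwS hwI hu h1.right
    exact hqa ((h1.dom y (fun e => hyI (e ▸ hu)) (fun e => h.sep.disjoint y hyA (e ▸ hb))
      hqy.symm).resolve_left (fun e => h.sep.not_adj y hyA b hb e.symm))
  · have hwS := h.sep.mem_of_notMem huS h1
    have hwI : w ∉ I := fun e => h.indep u hu w e h1.adj
    exact h1.right (hfull w hwS hwI b hb)

/-- For `b ∈ B \ I`, a vertex `f t` missing `b` has a head `t` without arcs from `A ∩ I`, so `t ∈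
A`. Two such heads would have an arc between them, so exactly one vertex `f a` of `S \ I` misses
`b`. Comparing `a` with `b` shows that `a` is alone in `A ∩ I`, and `harc` then makes it a king. -/
theorem false_of_forall (h : Kingless G S I A B f)
    (harc : ∀ b ∈ B, b ∈ I → ∃ a ∈ A, a ∈ I ∧ G.DominatesAllBut a (f b) b) : False := by
  obtain ⟨a₀, ha₀, haI₀⟩ := h.swap.exists_right
  obtain ⟨b₀, hb₀, hbI₀⟩ := h.exists_right
  have haS₀ := h.sep.notMem_left a₀ ha₀
  have hbS₀ := h.sep.notMem_right b₀ hb₀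
  obtain ⟨b, hb, hbI⟩ : ∃ b ∈ B, b ∉ I := by
    obtain ⟨b, hb, b', hb', hbb⟩ := h.sep.edge_right
    by_cases hbI : b ∈ I
    · exact ⟨b', hb', fun e => h.indep b hbI b' e hbb⟩
    · exact ⟨b, hb, hbI⟩
  have hbS := h.sep.notMem_right b hb
  have hIb : ∀ c ∈ I, c ≠ b := fun c hc e => hbI (e ▸ hc)
  have hout : ∀ a ∈ A, ∀ w t, t ∈ I → w ∈ S → G.DominatesAllBut a w t → G.Adj w b := by
    intro a ha w t ht hw hd
    exact (hd.dom b (hIb t ht).symm (fun e => h.sep.disjoint a ha (e ▸ hb))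
      (fun e => hbS (e ▸ hw))).resolve_left (h.sep.not_adj a ha b hb)
  -- the vertices of `S \ I` that miss `b`
  have hmiss : ∀ s ∈ S, s ∉ I → ¬ G.Adj s b → ∃ t ∈ I, t ∈ A ∧ s = f t ∧
      ∀ a ∈ I, a ∈ A → ∀ w, ¬ G.DominatesAllBut a w t := by
    intro s hs hsI hsb
    obtain ⟨t, ht, htS, rfl⟩ := h.exists_eq hs hsI
    have hno : ∀ a ∈ I, a ∈ A → ∀ w, ¬ G.DominatesAllBut a w t := by
      intro a ha haA w hw
      obtain rfl := h.eq_of_dominatesAllBut ha (h.sep.notMem_left a haA) ht hw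
      exact hsb (hout a haA _ t ht hs hw)
    refine ⟨t, ht, ?_, rfl, hno⟩
    rcases h.sep.cover t with h1 | h1 | h1
    · exact absurd h1 htS
    · exact h1
    · obtain ⟨a, ha, haI, hd⟩ := harc t h1 ht
      exact absurd hd (hno a haI ha _)
  have huniq : ∀ s ∈ S, s ∉ I → ¬ G.Adj s b → ∀ s' ∈ S, s' ∉ I → ¬ G.Adj s' b → s = s' := by
    intro s hs hsI hsb s' hs' hsI' hsb'
    obtain ⟨t, ht, htA, rfl, hno⟩ := hmiss s hs hsI hsb
    obtain ⟨t', ht', htA', rfl, hno'⟩ := hmiss s' hs' hsI' hsb'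
    by_cases htt : t = t'
    · rw [htt]
    · rcases h.sep.dominatesAllBut_or h.indep h.three_le ht ht' htt with ⟨w, hw⟩ | ⟨w, hw⟩
      · exact absurd hw (hno' t ht htA w)
      · exact absurd hw (hno t' ht' htA' w)
  obtain ⟨r, a, ha, haA, hrS, hrI, hrb, rfl, hno⟩ : ∃ r, ∃ a ∈ I, a ∈ A ∧ r ∈ S ∧ r ∉ I ∧
      ¬ G.Adj r b ∧ r = f a ∧ ∀ a' ∈ I, a' ∈ A → ∀ w, ¬ G.DominatesAllBut a' w a := by
    obtain ⟨s, hs, y, hy⟩ := h.sep.exists_dominatesAllBut b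
    by_cases hsI : s ∈ I
    · have hyI : y ∉ I := fun e => h.indep s hsI y e hy.adj
      by_cases hyS : y ∈ S
      · obtain ⟨t, ht, htA, e, hno⟩ := hmiss y hyS hyI hy.right
        exact ⟨y, t, ht, htA, hyS, hyI, hy.right, e, hno⟩
      · exfalso
        rcases h.sep.cover y with h1 | h1 | h1
        · exact hyS h1
        · rcases hy.dom b₀ (hIb b₀ hbI₀) (fun e => hbS₀ (e ▸ hs)) (fun e => hyI (e ▸ hbI₀))
            with h2 | h2
          · exact h.indep s hsI b₀ hbI₀ h2
          · exact h.sep.not_adj y h1 b₀ hb₀ h2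
        · rcases hy.dom a₀ (hIb a₀ haI₀) (fun e => haS₀ (e ▸ hs)) (fun e => hyI (e ▸ haI₀))
            with h2 | h2
          · exact h.indep s hsI a₀ haI₀ h2
          · exact h.sep.not_adj a₀ ha₀ y h1 h2.symm
    · obtain ⟨t, ht, htA, e, hno⟩ := hmiss s hs hsI hy.left
      exact ⟨s, t, ht, htA, hs, hsI, hy.left, e, hno⟩
  have haS := h.sep.notMem_left a haA
  have hra := (h.f_mem ha haS).2.2.1
  have hab : ¬ G.Adj a b := h.sep.not_adj a haA b hb
  rcases h.sep.pair a b (hIb a ha) hab with h1 | ⟨w, h1⟩ | ⟨w, h1⟩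
  · rcases h1 (f a) (fun e => haS (e ▸ hrS)) (fun e => hbS (e ▸ hrS)) with h2 | h2
    · exact hra h2.symm
    · exact hrb h2.symm
  · have hwS := h.sep.mem_of_notMem haS h1
    have hwI : w ∉ I := fun e => h.indep a ha w e h1.adj
    exact hra (huniq w hwS hwI h1.right (f a) hrS hrI hrb ▸ h1.adj.symm)
  · have hwS := h.sep.mem_of_notMem hbS h1
    have hwI : w ∈ I := by
      by_contra hwI
      obtain ⟨-, rfl⟩ := h.eq_of_not_adj hwS hwI ha h1.right
      exact hrb h1.adj.symm
    -- `a` is the only vertex of `I` on the left, and hence a king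
    have hone : ∀ a' ∈ I, a' ∈ A → a' = a := by
      intro a' ha' haA'
      by_contra hne
      rcases h1.dom a' hne (hIb a' ha') (fun e => h.sep.notMem_left a' haA' (e ▸ hwS))
        with h2 | h2
      · exact h.sep.not_adj a' haA' b hb h2.symm
      · exact h.indep w hwI a' ha' h2
    obtain ⟨t, ht, htS, hta, hnot⟩ := h.no_king a ha haS
    rcases h.sep.cover t with h2 | h2 | h2
    · exact htS h2
    · exact hta (hone t ht h2)
    · obtain ⟨a', ha', haI', hd⟩ := harc t h2 ht
      exact hnot _ (hone a' haI' ha' ▸ hd)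

/-- If some `b ∈ B ∩ I` receives no arc from `A ∩ I`, it sends arcs to all of `A ∩ I`, which is the
hypothesis of `false_of_forall` with the sides exchanged. -/
theorem false (h : Kingless G S I A B f) : False := by
  by_cases harc : ∀ b ∈ B, b ∈ I → ∃ a ∈ A, a ∈ I ∧ G.DominatesAllBut a (f b) b
  · exact h.false_of_forall harc
  · push Not at harc
    obtain ⟨b, hb, hbI, hno⟩ := harc
    refine h.swap.false_of_forall (fun a ha haI => ⟨b, hb, hbI, ?_⟩)
    have hab : a ≠ b := fun e => h.sep.disjoint a ha (e ▸ hb)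
    have haS := h.sep.notMem_left a ha
    have hbS := h.sep.notMem_right b hb
    rcases h.sep.dominatesAllBut_or h.indep h.three_le haI hbI hab with ⟨w, hw⟩ | ⟨w, hw⟩
    · exact absurd (h.eq_of_dominatesAllBut haI haS hbI hw ▸ hw) (hno a ha haI)
    · exact h.eq_of_dominatesAllBut hbI hbS haI hw ▸ hw

end Kingless

/-- No independent set with at least three vertices has the cardinality of `S`. -/
theorem false_of_indep (h : G.CriticalSeparation S A B)
    (hI : ∀ a ∈ I, ∀ b ∈ I, ¬ G.Adj a b) (hcard : I.card = S.card) (h3 : 3 ≤ I.card) : False := by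
  have hking : ∀ o ∈ I, o ∉ S → ∃ t ∈ I, t ∉ S ∧ t ≠ o ∧ ∀ w, ¬ G.DominatesAllBut o w t := by
    intro o ho hoS
    by_contra! hcon
    exact h.false_of_king hI hcard h3 ho hoS hcon
  have hsource : ∀ t ∈ I, t ∉ S → ∃ w, ∃ o ∈ I, o ∉ S ∧ o ≠ t ∧ G.DominatesAllBut o w t := by
    intro t ht htS
    obtain ⟨o, ho, hoS, hot, hno⟩ := hking t ht htS
    rcases h.dominatesAllBut_or hI h3 ht ho hot.symm with ⟨w, hw⟩ | ⟨w, hw⟩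
    · exact absurd hw (hno w)
    · exact ⟨w, o, ho, hoS, hot, hw⟩
  choose! f hf using hsource
  exact Kingless.false ⟨h, hI, hcard, h3, hf, hking⟩

end CriticalSeparation

/-! ### From criticality to dominating edges -/

theorem exists_dominating_pair {G : SimpleGraph V} (h : G.connectedDominationNumber < (3 : ℕ)) :
    ∃ x y, (x = y ∨ G.Adj x y) ∧ ∀ u, u ≠ x → u ≠ y → G.Adj x u ∨ G.Adj y u := by
  classical
  simp only [connectedDominationNumber, iInf_lt_iff, Nat.cast_lt] at h
  obtain ⟨D, ⟨hdom, hconn⟩, hcard⟩ := h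
  obtain ⟨⟨x, hx⟩⟩ := hconn.nonempty
  have hx : x ∈ D := hx
  by_cases hD : ∃ y ∈ D, y ≠ x
  · obtain ⟨y, hy, hyx⟩ := hD
    have hDxy : D = {x, y} := by
      symm
      apply Finset.eq_of_subset_of_card_le
      · simp [Finset.insert_subset_iff, hx, hy]
      · rw [Finset.card_pair hyx.symm]
        omega
    have : Nontrivial (D : Set V) := ⟨⟨x, hx⟩, ⟨y, hy⟩, by simpa using hyx.symm⟩
    obtain ⟨⟨z, hz⟩, hxz⟩ := hconn.preconnected.exists_adj_of_nontrivial ⟨x, hx⟩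
    have hxz : G.Adj x z := hxz
    have hz : z ∈ D := hz
    rw [hDxy] at hz
    simp only [Finset.mem_insert, Finset.mem_singleton] at hz
    have hzy : z = y := hz.resolve_left hxz.ne'
    refine ⟨x, y, Or.inr (hzy ▸ hxz), fun u hux huy => ?_⟩
    have := hdom u
    simp only [hDxy, Finset.mem_insert, Finset.mem_singleton, exists_eq_or_imp,
      exists_eq_left] at this
    tauto
  · push Not at hD
    refine ⟨x, x, Or.inl rfl, fun u hux _ => ?_⟩
    rcases hdom u with h1 | ⟨w, hw, h1⟩
    · exact absurd (hD u h1) hux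
    · exact Or.inl (hD w hw ▸ h1)

theorem exists_not_dominated {G : SimpleGraph V} (h : G.connectedDominationNumber = (3 : ℕ))
    (x y : V) (hxy : x = y ∨ G.Adj x y) :
    ∃ u, u ≠ x ∧ u ≠ y ∧ ¬ G.Adj x u ∧ ¬ G.Adj y u := by
  classical
  by_contra! hcon
  have hD : G.IsConnectedDominatingSet {x, y} := by
    refine ⟨fun v => ?_, ?_⟩
    · have := hcon v
      simp only [Finset.mem_insert, Finset.mem_singleton, exists_eq_or_imp, exists_eq_left]
      tauto
    · rcases hxy with rfl | hxy
      · rw [show (({x, x} : Finset V) : Set V) = {x} by simp]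
        exact Connected.of_subsingleton
      · rw [show (({x, y} : Finset V) : Set V) = {x, y} by simp]
        exact induce_pair_connected_of_adj hxy
  have h1 : G.connectedDominationNumber ≤ (({x, y} : Finset V).card : ℕ∞) :=
    iInf₂_le (f := fun (D : Finset V) (_ : G.IsConnectedDominatingSet D) => (D.card : ℕ∞)) _ hD
  rw [h, Nat.cast_le] at h1
  have := Finset.card_le_two (a := x) (b := y)
  omega

theorem isCutSet_of_neighbors {G : SimpleGraph V} {T : Finset V} {u v : V} (huv : u ≠ v)
    (hu : u ∉ T) (hv : v ∉ T) (hT : ∀ x, G.Adj v x → x ∈ T) : G.IsCutSet T := by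
  intro hpre
  have : Nontrivial ((T : Set V)ᶜ : Set V) := ⟨⟨u, hu⟩, ⟨v, hv⟩, by simpa using huv⟩
  obtain ⟨⟨z, hz⟩, hvz⟩ := hpre.exists_adj_of_nontrivial ⟨v, hv⟩
  exact hz (hT z hvz)

theorem IsMinimumCutSet.connectivity_eq [Finite V] {G : SimpleGraph V} {S : Finset V}
    (hS : G.IsMinimumCutSet S) : G.connectivity = S.card := by
  classical
  have := Fintype.ofFinite V
  apply le_antisymm
  · exact Nat.sInf_le ⟨S, rfl, Or.inl hS.1⟩
  · refine le_csInf ⟨S.card, S, rfl, Or.inl hS.1⟩ ?_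
    rintro k ⟨T, rfl, hT | hT⟩
    · exact hS.2 T hT
    · have h1 : Tᶜ.card ≤ 1 := Finset.card_le_one.2 fun a ha b hb =>
        hT (by simpa using ha) (by simpa using hb)
      have h2 : 1 < Sᶜ.card := by
        by_contra hcon
        have h3 := Finset.card_le_one.1 (not_lt.1 hcon)
        refine hS.1 (fun a b => ?_)
        rw [Subtype.ext (h3 a (Finset.mem_compl.2 a.2) b (Finset.mem_compl.2 b.2))]
      have := Finset.card_add_card_compl S
      have := Finset.card_add_card_compl T
      omega

theorem exists_adj_of_two_le_connectivity {G : SimpleGraph V} (h : 2 ≤ G.connectivity) {u v : V}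
    (huv : u ≠ v) : ∃ w, G.Adj v w := by
  by_contra! hcon
  have h1 : G.connectivity ≤ 0 := Nat.sInf_le ⟨∅, rfl, Or.inl
    (isCutSet_of_neighbors huv (by simp) (by simp) (fun x hx => absurd hx (hcon x)))⟩
  omega

/-- A pair of non-adjacent vertices in a `3`-`γ_c`-edge critical graph without isolated
vertices. -/
theorem IsConnectedDominationEdgeCritical.dominatesAllBut {G : SimpleGraph V}
    (h : G.IsConnectedDominationEdgeCritical 3) (hadj : ∀ u v : V, u ≠ v → ∃ w, G.Adj v w)
    {u v : V} (huv : u ≠ v) (hnadj : ¬ G.Adj u v) :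
    (∀ x, x ≠ u → x ≠ v → G.Adj u x ∨ G.Adj v x) ∨
      (∃ w, G.DominatesAllBut u w v) ∨ ∃ w, G.DominatesAllBut v w u := by
  obtain ⟨x, y, hxy, hdom⟩ := exists_dominating_pair (h.2 u v huv hnadj)
  simp only [sup_adj, edge_adj] at hxy hdom
  -- a vertex dominating everything but one vertex
  have hno : ∀ a b, a ≠ b → ¬ ∀ c, c ≠ a → c ≠ b → G.Adj a c := by
    intro a b hab hc
    obtain ⟨w, hw⟩ := hadj a b hab
    have hwa : w = a ∨ G.Adj a w := by
      by_cases hwa : w = a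
      · exact Or.inl hwa
      · exact Or.inr (hc w hwa hw.ne')
    -- The vertex `a` and the neighbour `w` of `b` would form a connected dominating set with at
    -- most two vertices.
    obtain ⟨z, hza, hzw, hz, hz'⟩ := exists_not_dominated h.1 a w (hwa.imp_left Eq.symm)
    by_cases hzb : z = b
    · exact hz' (hzb ▸ hw.symm)
    · exact hz (hc z hza hzb)
  by_cases hxy' : x = y
  · subst hxy'
    exfalso
    obtain ⟨z, hzx, -, hz, -⟩ := exists_not_dominated h.1 x x (Or.inl rfl)
    refine hno x z hzx.symm (fun c hcx hcz => ?_)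
    have := hdom c hcx hcx
    have := hdom z hzx hzx
    grind
  by_cases hadj' : G.Adj x y
  · obtain ⟨z, hzx, hzy, hz, hz'⟩ := exists_not_dominated h.1 x y (Or.inr hadj')
    have hzdom := hdom z hzx hzy
    have hall : ∀ c, c ≠ z → c ≠ x → c ≠ y → G.Adj x c ∨ G.Adj y c := by
      intro c hcz hcx hcy
      have := hdom c hcx hcy
      grind
    have hd : G.DominatesAllBut x y z := ⟨hadj', hzx.symm, hzy.symm, hz, hz', hall⟩
    have hd' := hd.symm
    right
    rcases hzdom with h1 | h1
    · rcases h1.resolve_left hz with ⟨⟨rfl, rfl⟩ | ⟨rfl, rfl⟩, -⟩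
      · exact Or.inl ⟨y, hd⟩
      · exact Or.inr ⟨y, hd⟩
    · rcases h1.resolve_left hz' with ⟨⟨rfl, rfl⟩ | ⟨rfl, rfl⟩, -⟩
      · exact Or.inl ⟨x, hd'⟩
      · exact Or.inr ⟨x, hd'⟩
  -- Here `xy` is the added edge, so `x` and `y` are `u` and `v`.
  · left
    intro c hcu hcv
    have := hdom c
    grind

theorem IsConnectedDominationVertexCritical.dominatesAllBut {G : SimpleGraph V}
    (h : G.IsConnectedDominationVertexCritical 3) (v : V) : ∃ x y, G.DominatesAllBut x y v := by
  obtain ⟨⟨x, hx⟩, ⟨y, hy⟩, hxy, hdom⟩ := exists_dominating_pair (h.2.2 v)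
  have hx : x ≠ v := hx
  have hy : y ≠ v := hy
  simp only [Subtype.mk.injEq, comap_adj, Function.Embedding.subtype_apply, Subtype.forall,
    Set.mem_compl_iff, Set.mem_singleton_iff, ne_eq] at hxy hdom
  obtain ⟨z, hzx, hzy, hz, hz'⟩ := exists_not_dominated h.2.1 x y hxy
  have hzv : z = v := by
    by_contra hzv
    rcases hdom z hzv hzx hzy with h1 | h1
    · exact hz h1
    · exact hz' h1
  subst hzv
  rcases hxy with rfl | hxy
  · exfalso
    obtain ⟨w, hw⟩ := exists_adj_of_two_le_connectivity h.1 hx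
    have hwx : x = w ∨ G.Adj x w := by
      by_cases hwx : w = x
      · exact Or.inl hwx.symm
      · exact Or.inr ((or_self_iff).1 (hdom w hw.ne' hwx hwx))
    obtain ⟨q, hqx, hqw, hq, hq'⟩ := exists_not_dominated h.2.1 x w hwx
    by_cases hqz : q = z
    · exact hq' (hqz ▸ hw.symm)
    · exact hq ((or_self_iff).1 (hdom q hqz hqx hqx))
  · exact ⟨x, y, hxy, hx, hy, hz, hz', hdom⟩

/-- If no component of `G - S` is a single vertex, then every vertex outside `S` has a neighbour
outside `S`. -/
theorem exists_adj_of_forall_supp_ne {G : SimpleGraph V} {S : Set V}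
    (h : ¬ ∃ C : (G.induce S).ConnectedComponent, ∃ x, C.supp = {x}) (x : S) :
    ∃ y, (G.induce S).Adj x y := by
  by_contra! hcon
  refine h ⟨(G.induce S).connectedComponentMk x, x, ?_⟩
  ext y
  simp only [ConnectedComponent.mem_supp_iff, ConnectedComponent.eq, Set.mem_singleton_iff]
  constructor
  · rintro hyx
    by_contra hne
    obtain ⟨z, hz⟩ := mem_support_of_reachable (Ne.symm hne) hyx.symm
    exact hcon z hz
  · rintro rfl
    exact Reachable.refl _

theorem IsMaximalConnectedDominationVertexCritical.exists_criticalSeparation {G : SimpleGraph V}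
    (hG : G.IsMaximalConnectedDominationVertexCritical 3) {S : Finset V}
    (hS : G.IsMinimumCutSet S)
    (h : ¬ ∃ C : (G.induce ((S : Set V)ᶜ)).ConnectedComponent, ∃ x, C.supp = {x}) :
    ∃ A B, G.CriticalSeparation S A B := by
  have hcut := hS.1
  simp only [IsCutSet, Preconnected, not_forall] at hcut
  obtain ⟨x, y, hxy⟩ := hcut
  have hstep := exists_adj_of_forall_supp_ne h
  refine ⟨{v | ∃ hv : v ∉ S, (G.induce ((S : Set V)ᶜ)).Reachable x ⟨v, hv⟩},
    {v | ∃ hv : v ∉ S, ¬ (G.induce ((S : Set V)ᶜ)).Reachable x ⟨v, hv⟩}, ?_, ?_, ?_, ?_, ?_, ?_, ?_,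
    ?_, ?_, ?_⟩
  · intro v
    by_cases hv : v ∈ S
    · exact Or.inl hv
    · right
      by_cases hr : (G.induce ((S : Set V)ᶜ)).Reachable x ⟨v, hv⟩
      · exact Or.inl ⟨hv, hr⟩
      · exact Or.inr ⟨hv, hr⟩
  · rintro v ⟨hv, -⟩
    exact hv
  · rintro v ⟨hv, -⟩
    exact hv
  · rintro v ⟨hv, hr⟩ ⟨_, hr'⟩
    exact hr' hr
  · rintro a ⟨ha, hra⟩ b ⟨hb, hrb⟩ hab
    have hab' : (G.induce ((S : Set V)ᶜ)).Adj ⟨a, ha⟩ ⟨b, hb⟩ := hab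
    exact hrb (hra.trans hab'.reachable)
  · obtain ⟨z, hz⟩ := hstep x
    exact ⟨x, ⟨x.2, Reachable.refl _⟩, z, ⟨z.2, hz.reachable⟩, hz⟩
  · obtain ⟨z, hz⟩ := hstep y
    exact ⟨y, ⟨y.2, hxy⟩, z, ⟨z.2, fun hr => hxy (hr.trans hz.symm.reachable)⟩, hz⟩
  · intro u v huv hnadj
    exact hG.1.dominatesAllBut (fun _ _ => exists_adj_of_two_le_connectivity hG.2.1) huv hnadj
  · exact hG.2.dominatesAllBut
  · intro T u v huv hu hv hT
    exact hS.2 T (isCutSet_of_neighbors huv hu hv hT)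

end SimpleGraph

theorem theorem4p5 {V : Type*} [Finite V] (G : SimpleGraph V)
    (hG : G.IsMaximalConnectedDominationVertexCritical 3)
    (hα : G.indepNum = G.connectivity)
    (S : Finset V) (hS : G.IsMinimumCutSet S) :
    ∃ C : (G.induce ((S : Set V)ᶜ)).ConnectedComponent, ∃ x, C.supp = {x} := by
  classical
  have := Fintype.ofFinite V
  by_contra hcon
  obtain ⟨A, B, hsep⟩ := hG.exists_criticalSeparation hS hcon
  have hconn := hS.connectivity_eq
  have hindep : ∀ J : Finset V, (∀ a ∈ J, ∀ b ∈ J, a ≠ b → ¬ G.Adj a b) → J.card ≤ S.card := by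
    intro J hJ
    rw [← hconn, ← hα]
    exact SimpleGraph.IsIndepSet.card_le_indepNum (fun a ha b hb hab => hJ a ha b hb hab)
  obtain ⟨I, hI, hcard⟩ := G.exists_isNIndepSet_indepNum
  have hI' : ∀ a ∈ I, ∀ b ∈ I, ¬ G.Adj a b := fun a ha b hb hab =>
    hI (Finset.mem_coe.2 ha) (Finset.mem_coe.2 hb) hab.ne hab
  have htwo := hG.2.1
  by_cases h3 : 3 ≤ I.card
  · exact hsep.false_of_indep hI' (by omega) h3
  · obtain ⟨x, y, z, hxy, hxz, hyz, h1, h2, h4⟩ :=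
      hsep.exists_three_of_card_eq_two (by omega)
    have h5 := hindep {x, y, z} (by
      simp only [Finset.mem_insert, Finset.mem_singleton]
      rintro a (rfl | rfl | rfl) b (rfl | rfl | rfl) hab <;> simp_all [G.adj_comm])
    rw [Finset.card_eq_three.2 ⟨x, y, z, hxy, hxz, hyz, rfl⟩] at h5
    omega
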